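/- For integers $n \ge 1$ and $0 \le m < n$, let \[ H(n,m) = \langle x_0, \dots, x_{n-1} \mid x_i x_{i+m} = x_{i+1} \ (0 \le i < n) \rangle \] be the Gilbert--Howie group, where indices are taken modulo $n$, and let $H(n,m)^{\mathrm{ab}}$ denote its abelianization. **Theorem.** For all integers $n \ge 1$ and $0 \le m < n$, $H(n,m)^{\mathrm{ab}} \cong \mathbb{Z}^2$ if and only if $n \equiv 0 \pmod 6$ and $m \equiv 2 \pmod n$. -/

import Mathlib

/-- The relators `x_i * x_{i+m} * x_{i+k}⁻¹`, one for each `i` modulo `n`, in the free group on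
generators `x_i` indexed by the residues modulo `n`. -/
def fibonacciTypeRelators (n m k : ℕ) : Set (FreeGroup (ZMod n)) :=
  Set.range fun i : ZMod n =>
    FreeGroup.of i * FreeGroup.of (i + (m : ZMod n)) * (FreeGroup.of (i + (k : ZMod n)))⁻¹

/-- The cyclically presented group of Fibonacci type
`G_n(m,k) = ⟨x_0, …, x_{n-1} ∣ x_i x_{i+m} = x_{i+k} (0 ≤ i < n)⟩`, indices modulo `n`
(used for `n ≥ 1`). -/
abbrev FibonacciTypeGroup (n m k : ℕ) : Type :=
  PresentedGroup (fibonacciTypeRelators n m k)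

/-- The Gilbert–Howie group `H(n,m) = G_n(m,1)`. -/
abbrev GilbertHowieGroup (n m : ℕ) : Type :=
  FibonacciTypeGroup n m 1

/-! Reading x_i as X^i identifies the abelianization with ℤ[X]/(X^n - 1, f), where f = X^m - X + 1.
A common complex root z has |z| = |z - 1| = 1, so it is a primitive sixth root of unity, and 6 ∣ n,
m ≡ 2 mod 6 (`modEq_two_of_common_root`). Without common roots a torsion-free quotient is zero; with
them, torsion-freeness puts Φ = X² - X + 1 in the ideal.

Put N = n/2 and f = Φg. Cancelling Φ makes g a unit of ℤ[x]/(x^N - ε), the sign ε being chosen so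
that Φ ∣ X^N + ε. Write a bar for x ↦ x⁻¹. As Φ̄ = x⁻²Φ, the unit v = x⁻²ḡ/g satisfies vf = f̄ and v
v̄ = 1. The constant coefficient of v v̄ is the sum of the squares of the coefficients of v, so v =
±x^i (`exists_shift_of_mul_invert_eq_one`). Comparing coefficients in f̄ = ±x^i f leaves only m = 2.

Conversely, x_{i+2} = x_{i+1} - x_i has period six, so 6 ∣ n leaves x_0, x_1 free. -/

/-- Values of the twisted trace on monomials: the coefficient of `1` in `x ^ j` when `x ^ N = ε`. -/
def signedIndicator (N : ℕ) (ε : ℤ) (j : ℤ) : ℤ :=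
  if (2 * N : ℤ) ∣ j then 1 else if (N : ℤ) ∣ j then ε else 0

/-! ### Coefficients of powers of x when x^N = ε -/

section SignedIndicator

variable {N : ℕ} {ε : ℤ}

theorem signedIndicator_neg (j : ℤ) : signedIndicator N ε (-j) = signedIndicator N ε j := by
  simp [signedIndicator]

theorem signedIndicator_zero : signedIndicator N ε 0 = 1 := by
  simp [signedIndicator]

theorem signedIndicator_eq_zero {j : ℤ} (h : ¬(N : ℤ) ∣ j) : signedIndicator N ε j = 0 := by
  have h2 : ¬(2 * N : ℤ) ∣ j := fun h' => h (Dvd.dvd.trans (Dvd.intro_left _ rfl) h')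
  simp [signedIndicator, h, h2]

theorem dvd_of_signedIndicator_ne_zero {j : ℤ} (h : signedIndicator N ε j ≠ 0) :
    (N : ℤ) ∣ j := by
  by_contra h'
  exact h (signedIndicator_eq_zero h')

theorem signedIndicator_add_self (hN : 0 < N) (hε : ε * ε = 1) (j : ℤ) :
    signedIndicator N ε (j + N) = ε * signedIndicator N ε j := by
  by_cases h : (N : ℤ) ∣ j
  · obtain ⟨k, rfl⟩ := h
    have hN' : (N : ℤ) ≠ 0 := by exact_mod_cast hN.ne'
    have e1 : ∀ a : ℤ, (2 * N : ℤ) ∣ N * a ↔ 2 ∣ a := fun a => by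
      rw [mul_comm (2 : ℤ), mul_dvd_mul_iff_left hN']
    have e2 : (N : ℤ) * k + N = N * (k + 1) := by ring
    rw [e2]
    simp only [signedIndicator, e1, dvd_mul_right, if_true]
    by_cases hk : (2 : ℤ) ∣ k
    · rw [if_pos hk, if_neg (by omega), mul_one]
    · rw [if_neg hk, if_pos (by omega), hε]
  · rw [signedIndicator_eq_zero h, signedIndicator_eq_zero, mul_zero]
    rwa [dvd_add_self_right]

theorem signedIndicator_add_mul (hN : 0 < N) (hε : ε * ε = 1) (j k : ℤ) :
    signedIndicator N ε (j + N * k) =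
      signedIndicator N ε (N * k) * signedIndicator N ε j := by
  induction k using Int.induction_on with
  | zero => simp [signedIndicator_zero]
  | succ i ih =>
    have h := signedIndicator_add_self hN hε
    rw [mul_add, mul_one, ← add_assoc, h, ih, h, mul_assoc]
  | pred i ih =>
    have h := signedIndicator_add_self hN hε
    have h1 := h (j + N * (-i - 1))
    have h2 := h (N * (-i - 1))
    rw [show j + N * (-i - 1) + N = j + N * (-(i : ℤ)) by ring, ih] at h1
    rw [show (N : ℤ) * (-i - 1) + N = N * (-(i : ℤ)) by ring] at h2
    rw [h2] at h1
    linear_combination (-ε) * h1 +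
      (signedIndicator N ε (N * (-i - 1)) * signedIndicator N ε j -
        signedIndicator N ε (j + N * (-i - 1))) * hε

/-- Only the residue of a modulo N contributes to the sum. This is the orthonormality of 1, x, …,
x^(N-1) for the form tr(p q̄). -/
theorem signedIndicator_sub_eq_sum (hN : 0 < N) (hε : ε * ε = 1) (a b : ℤ) :
    signedIndicator N ε (a - b) = ∑ i ∈ Finset.range N,
      signedIndicator N ε (a - i) * signedIndicator N ε (b - i) := by
  have hN' : (0 : ℤ) < N := by exact_mod_cast hN
  obtain ⟨r, hr⟩ : ∃ r : ℕ, (r : ℤ) = a % N :=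
    ⟨(a % N).toNat, Int.toNat_of_nonneg (Int.emod_nonneg _ hN'.ne')⟩
  have hrN : r < N := by
    have := Int.emod_lt_of_pos a hN'
    omega
  have har : a = r + N * (a / N) := by rw [hr]; exact (Int.emod_add_mul_ediv a N).symm
  rw [Finset.sum_eq_single_of_mem r (Finset.mem_range.2 hrN)]
  · have h1 := signedIndicator_add_mul hN hε (r - b) (a / N)
    have e1 : a - b = r - b + N * (a / N) := by linarith
    have e2 : a - r = N * (a / N) := by linarith
    rw [e1, h1, e2, ← signedIndicator_neg (b - r), neg_sub]
  · intro i hi hir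
    rw [signedIndicator_eq_zero, zero_mul]
    intro hd
    have : (N : ℤ) ∣ r - i := by
      have := dvd_sub hd (Dvd.intro (a / N) rfl : (N : ℤ) ∣ N * (a / N))
      rwa [show a - i - N * (a / N) = r - i by linarith] at this
    rw [Finset.mem_range] at hi
    have := Int.eq_zero_of_abs_lt_dvd this (by rw [abs_lt]; omega)
    omega

end SignedIndicator

/-! ### The twisted trace and units with v v̄ = 1 -/

section LaurentPolynomial

open LaurentPolynomial

/-- The linear functional `x ^ j ↦ signedIndicator N ε j`, which is the coefficient of `1`
in `ℤ[x] / (x ^ N - ε)`. -/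
noncomputable def twistedTrace (N : ℕ) (ε : ℤ) : ℤ[T;T⁻¹] →ₗ[ℤ] ℤ :=
  Finsupp.linearCombination ℤ (signedIndicator N ε) ∘ₗ
    (AddMonoidAlgebra.coeffLinearEquiv ℤ).toLinearMap

section TwistedTrace

variable {N : ℕ} {ε : ℤ}

theorem twistedTrace_T (j : ℤ) : twistedTrace N ε (T j) = signedIndicator N ε j := by
  simp only [twistedTrace, T, LinearMap.comp_apply]
  exact (Finsupp.linearCombination_single ℤ 1 j).trans (one_smul _ _)

theorem twistedTrace_C_mul (a : ℤ) (p : ℤ[T;T⁻¹]) :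
    twistedTrace N ε (C a * p) = a * twistedTrace N ε p := by
  rw [← LaurentPolynomial.smul_eq_C_mul, map_smul, smul_eq_mul]

theorem twistedTrace_invert (p : ℤ[T;T⁻¹]) :
    twistedTrace N ε (invert p) = twistedTrace N ε p := by
  induction p using LaurentPolynomial.induction_on' with
  | add p q hp hq => rw [map_add, map_add, map_add, hp, hq]
  | C_mul_T n a =>
    rw [map_mul, invert_C, invert_T, twistedTrace_C_mul, twistedTrace_C_mul, twistedTrace_T,
      twistedTrace_T, signedIndicator_neg]

theorem twistedTrace_mul_eq_zero (hN : 0 < N) (hε : ε * ε = 1) (p : ℤ[T;T⁻¹]) :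
    twistedTrace N ε ((T N - C ε) * p) = 0 := by
  induction p using LaurentPolynomial.induction_on' with
  | add p q hp hq => rw [mul_add, map_add, hp, hq, add_zero]
  | C_mul_T n a =>
    have : (T N - C ε) * (C a * T n) = C a * T (n + N) - C a * (C ε * T n) := by
      rw [T_add]; ring
    rw [this, map_sub, twistedTrace_C_mul, twistedTrace_C_mul, twistedTrace_C_mul, twistedTrace_T,
      twistedTrace_T, signedIndicator_add_self hN hε, sub_self]

theorem twistedTrace_mul_invert (hN : 0 < N) (hε : ε * ε = 1) (p q : ℤ[T;T⁻¹]) :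
    twistedTrace N ε (p * invert q) = ∑ i ∈ Finset.range N,
      twistedTrace N ε (p * T (-i)) * twistedTrace N ε (q * T (-i)) := by
  induction p using LaurentPolynomial.induction_on' with
  | add p₁ p₂ h₁ h₂ =>
    simp only [add_mul, map_add, h₁, h₂, Finset.sum_add_distrib]
  | C_mul_T a r =>
    induction q using LaurentPolynomial.induction_on' with
    | add q₁ q₂ h₁ h₂ =>
      simp only [add_mul, mul_add, map_add, h₁, h₂, Finset.sum_add_distrib]
    | C_mul_T b s =>
      have e : C r * T a * invert (C s * T b) = C r * (C s * T (a - b)) := by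
        rw [map_mul, invert_C, invert_T, T_sub]; ring
      have e' : ∀ (r c : ℤ) (i : ℤ), C r * T c * T (-i) = C r * T (c - i) := fun r c i => by
        rw [T_sub, mul_assoc]
      simp only [e, e', twistedTrace_C_mul, twistedTrace_T, signedIndicator_sub_eq_sum hN hε a b,
        Finset.mul_sum]
      exact Finset.sum_congr rfl fun i _ => by ring

/-- An element `v` of `ℤ[x] / (x ^ N - ε)` with `v * v⁻ = 1` is `± x ^ i`, in the form that
multiplication by it shifts coefficients up to a sign. -/
theorem exists_shift_of_mul_invert_eq_one (hN : 0 < N) (hε : ε * ε = 1) {v p q r s : ℤ[T;T⁻¹]}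
    (hv : v * invert v = 1 + (T N - C ε) * r) (hpq : v * p = q + (T N - C ε) * s) :
    ∃ (σ i : ℤ), (σ = 1 ∨ σ = -1) ∧
      ∀ j : ℤ, twistedTrace N ε (q * T j) = σ * twistedTrace N ε (p * T (i + j)) := by
  set c : ℕ → ℤ := fun i => twistedTrace N ε (v * T (-i)) with hc
  -- Integer squares with sum 1: a single coefficient is nonzero, and it is ±1.
  have hsum : ∑ i ∈ Finset.range N, c i * c i = 1 := by
    rw [← twistedTrace_mul_invert hN hε, hv, map_add, twistedTrace_mul_eq_zero hN hε, ← T_zero,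
      twistedTrace_T, signedIndicator_zero, add_zero]
  obtain ⟨i, hi, hci⟩ : ∃ i ∈ Finset.range N, c i ≠ 0 := by
    by_contra! h
    rw [Finset.sum_eq_zero fun i hi => by rw [h i hi, zero_mul]] at hsum
    exact zero_ne_one hsum
  have hsplit := Finset.add_sum_erase _ (fun i => c i * c i) hi
  rw [hsum] at hsplit
  have hnn : 0 ≤ ∑ k ∈ (Finset.range N).erase i, c k * c k :=
    Finset.sum_nonneg fun k _ => mul_self_nonneg _
  have hpos : 0 < c i * c i := mul_self_pos.2 hci
  have h1 : c i * c i = 1 := by linarith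
  have h0 : ∑ k ∈ (Finset.range N).erase i, c k * c k = 0 := by linarith
  rw [Finset.sum_eq_zero_iff_of_nonneg fun k _ => mul_self_nonneg _] at h0
  refine ⟨c i, i, mul_self_eq_one_iff.1 h1, fun j => ?_⟩
  have e1 : q * T j = v * invert (invert (p * T j)) + (T N - C ε) * (-(s * T j)) := by
    rw [LaurentPolynomial.involutive_invert]
    linear_combination (-T j) * hpq
  rw [e1, map_add, twistedTrace_mul_eq_zero hN hε, add_zero, twistedTrace_mul_invert hN hε,
    Finset.sum_eq_single_of_mem i hi]
  · congr 1
    have e2 : invert (p * T j) * T (-i) = invert (p * T (i + j)) := by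
      rw [map_mul, map_mul, invert_T, invert_T, mul_assoc, ← T_add, neg_add_rev]
    rw [e2, twistedTrace_invert]
  · intro k hk hki
    have := h0 k (Finset.mem_erase.2 ⟨hki, hk⟩)
    rw [show twistedTrace N ε (v * T (-k)) = 0 from mul_self_eq_zero.1 this, zero_mul]

end TwistedTrace

/-! ### Comparing the coefficients of f̄ and ±x^i f -/

section SignedIndicator

variable {N : ℕ} {ε : ℤ}

theorem signedIndicator_of_dvd {j : ℤ} (h : (N : ℤ) ∣ j) :
    signedIndicator N 1 j = 1 := by
  simp [signedIndicator, h]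

theorem dvd_and_eq_neg_one_of_signedIndicator_eq_neg (hε : ε = 1 ∨ ε = -1) {σ a b : ℤ}
    (hσ : σ ≠ 0) (ha : signedIndicator N ε a = σ) (hb : signedIndicator N ε b = -σ) :
    (N : ℤ) ∣ a - b ∧ ε = -1 := by
  have hNa := dvd_of_signedIndicator_ne_zero (ha.trans_ne hσ)
  have hNb := dvd_of_signedIndicator_ne_zero (hb.trans_ne (neg_ne_zero.2 hσ))
  refine ⟨dvd_sub hNa hNb, hε.resolve_left ?_⟩
  rintro rfl
  rw [signedIndicator_of_dvd hNa] at ha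
  rw [signedIndicator_of_dvd hNb] at hb
  omega

theorem two_mul_dvd_of_signedIndicator_eq {σ a b : ℤ}
    (hσ : σ ≠ 0) (ha : signedIndicator N (-1) a = σ) (hb : signedIndicator N (-1) b = σ) :
    (2 * N : ℤ) ∣ a - b := by
  obtain ⟨k, hk⟩ := dvd_of_signedIndicator_ne_zero (ha.trans_ne hσ)
  obtain ⟨l, hl⟩ := dvd_of_signedIndicator_ne_zero (hb.trans_ne hσ)
  rcases Nat.eq_zero_or_pos N with rfl | hN
  · simp_all
  have hN' : (N : ℤ) ≠ 0 := by exact_mod_cast hN.ne'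
  have e1 : ∀ c : ℤ, (2 * N : ℤ) ∣ N * c ↔ 2 ∣ c := fun c => by
    rw [mul_comm (2 : ℤ), mul_dvd_mul_iff_left hN']
  subst hk hl
  rw [← mul_sub, e1]
  simp only [signedIndicator, e1, dvd_mul_right, if_true] at ha hb
  split_ifs at ha hb <;> omega

/-- As 3 ∣ N and 0, 1, m are distinct modulo 3, at most one term survives on each side. Testing j =
0, 1, m: if i ≡ 0 or 2 mod 3, opposite signs occur at exponents of odd difference divisible by N,
although opposite signs need ε = -1 and hence N even; if i ≡ 1, then 2N ∣ m - 2. -/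
theorem eq_two_of_signedIndicator_shift (hN : (3 : ℤ) ∣ N)
    (hε : (ε = 1 ∧ Odd N) ∨ (ε = -1 ∧ Even N)) {m : ℕ} (hm : m % 6 = 2) (hmN : m < 2 * N)
    {σ i : ℤ} (hσ : σ = 1 ∨ σ = -1)
    (h : ∀ j : ℤ, signedIndicator N ε j + signedIndicator N ε (j - m) -
      signedIndicator N ε (j - 1) = σ * (signedIndicator N ε (i + j) +
        signedIndicator N ε (i + j + m) - signedIndicator N ε (i + j + 1))) : m = 2 := by
  have hz : ∀ {j : ℤ}, ¬(3 : ℤ) ∣ j → signedIndicator N ε j = 0 := fun hj =>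
    signedIndicator_eq_zero fun hd => hj (hN.trans hd)
  have hε' : ε = 1 ∨ ε = -1 := hε.imp And.left And.left
  have hpar : ε = -1 → (2 : ℤ) ∣ N := by
    rintro rfl
    have := hε.resolve_left (by norm_num)
    exact_mod_cast this.2.two_dvd
  have hσ0 : σ ≠ 0 := by omega
  have h0 := h 0
  have h1 := h 1
  have h2 := h m
  rw [signedIndicator_zero, hz (by omega : ¬(3 : ℤ) ∣ 0 - m),
    hz (by omega : ¬(3 : ℤ) ∣ 0 - 1)] at h0
  rw [sub_self, signedIndicator_zero, hz (by omega : ¬(3 : ℤ) ∣ 1),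
    hz (by omega : ¬(3 : ℤ) ∣ 1 - m)] at h1
  rw [sub_self, signedIndicator_zero, hz (by omega : ¬(3 : ℤ) ∣ m),
    hz (by omega : ¬(3 : ℤ) ∣ m - 1)] at h2
  have hi : i % 3 = 0 ∨ i % 3 = 1 ∨ i % 3 = 2 := by omega
  rcases hi with hi | hi | hi
  · rw [hz (by omega : ¬(3 : ℤ) ∣ i + 0 + m), hz (by omega : ¬(3 : ℤ) ∣ i + 0 + 1)] at h0
    rw [hz (by omega : ¬(3 : ℤ) ∣ i + 1), hz (by omega : ¬(3 : ℤ) ∣ i + 1 + 1)] at h1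
    obtain ⟨hd, he⟩ := dvd_and_eq_neg_one_of_signedIndicator_eq_neg (N := N) hε' hσ0
      (a := i + 0) (b := i + 1 + m) (by rcases hσ with rfl | rfl <;> omega)
      (by rcases hσ with rfl | rfl <;> omega)
    have := (hpar he).trans hd
    omega
  · rw [hz (by omega : ¬(3 : ℤ) ∣ i + 0), hz (by omega : ¬(3 : ℤ) ∣ i + 0 + 1)] at h0
    rw [hz (by omega : ¬(3 : ℤ) ∣ i + 1), hz (by omega : ¬(3 : ℤ) ∣ i + 1 + m)] at h1
    have e0 : signedIndicator N ε (i + 0 + m) = σ := by rcases hσ with rfl | rfl <;> omega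
    have e1 : signedIndicator N ε (i + 1 + 1) = σ := by rcases hσ with rfl | rfl <;> omega
    have hd : (2 * N : ℤ) ∣ m - 2 := by
      rcases hε with ⟨rfl, hodd⟩ | ⟨rfl, -⟩
      · have hd : (N : ℤ) ∣ m - 2 := by
          have := dvd_sub (dvd_of_signedIndicator_ne_zero (e0.trans_ne hσ0))
            (dvd_of_signedIndicator_ne_zero (e1.trans_ne hσ0))
          rwa [show i + 0 + m - (i + 1 + 1) = (m : ℤ) - 2 by ring] at this
        -- N is odd and m is even, which supplies the extra factor 2.
        refine IsCoprime.mul_dvd ?_ (by omega) hd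
        rw [Int.isCoprime_iff_gcd_eq_one]
        exact hodd.coprime_two_left
      · have := two_mul_dvd_of_signedIndicator_eq hσ0 e0 e1
        rwa [show i + 0 + m - (i + 1 + 1) = (m : ℤ) - 2 by ring] at this
    have := Int.eq_zero_of_abs_lt_dvd hd (by rw [abs_lt]; omega)
    omega
  · rw [hz (by omega : ¬(3 : ℤ) ∣ i + 0), hz (by omega : ¬(3 : ℤ) ∣ i + 0 + m)] at h0
    rw [hz (by omega : ¬(3 : ℤ) ∣ i + m), hz (by omega : ¬(3 : ℤ) ∣ i + m + 1)] at h2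
    obtain ⟨hd, he⟩ := dvd_and_eq_neg_one_of_signedIndicator_eq_neg (N := N) hε' hσ0
      (a := i + m + m) (b := i + 0 + 1) (by rcases hσ with rfl | rfl <;> omega)
      (by rcases hσ with rfl | rfl <;> omega)
    have := (hpar he).trans hd
    omega

end SignedIndicator

/-! ### Cancelling X² - X + 1 -/

section Polynomial

open Polynomial

theorem X_sq_sub_X_add_one_dvd_X_pow_mul_add_one {k : ℕ} (hk : Odd k) :
    (X ^ 2 - X + 1 : ℤ[X]) ∣ X ^ (3 * k) + 1 := by
  have h := hk.add_dvd_pow_add_pow (X ^ 3 : ℤ[X]) 1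
  rw [one_pow, ← pow_mul] at h
  exact Dvd.dvd.trans ⟨X + 1, by ring⟩ h

theorem X_sq_sub_X_add_one_dvd_X_pow_mul_sub_one (k : ℕ) :
    (X ^ 2 - X + 1 : ℤ[X]) ∣ X ^ (6 * k) - 1 := by
  have h := sub_dvd_pow_sub_pow (X ^ 6 : ℤ[X]) 1 k
  rw [one_pow, ← pow_mul] at h
  exact Dvd.dvd.trans ⟨(X + 1) * (X ^ 3 - 1), by ring⟩ h

theorem X_sq_sub_X_add_one_dvd_trinomial {m : ℕ} (hm : m % 6 = 2) :
    (X ^ 2 - X + 1 : ℤ[X]) ∣ X ^ m - X + 1 := by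
  obtain ⟨c, hc⟩ := X_sq_sub_X_add_one_dvd_X_pow_mul_sub_one (m / 6)
  refine ⟨X ^ 2 * c + 1, ?_⟩
  rw [show m = 6 * (m / 6) + 2 by omega, pow_add]
  linear_combination X ^ 2 * hc

theorem X_sq_sub_X_add_one_ne_zero : (X ^ 2 - X + 1 : ℤ[X]) ≠ 0 := fun h => by
  simpa using congrArg (Polynomial.eval 0) h

/-- `X ^ (6k) - 1 = (X ^ (3k) - ε)(X ^ (3k) + ε)` for either sign; the sign is chosen so that
`X ^ 2 - X + 1` divides the second factor. -/
theorem exists_sign_dvd_X_pow_add (k : ℕ) :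
    ∃ ε : ℤ, ((ε = 1 ∧ Odd (3 * k)) ∨ (ε = -1 ∧ Even (3 * k))) ∧
      (X ^ 2 - X + 1 : ℤ[X]) ∣ X ^ (3 * k) + Polynomial.C ε := by
  rcases Nat.even_or_odd k with hk | hk
  · refine ⟨-1, Or.inr ⟨rfl, hk.mul_left 3⟩, ?_⟩
    obtain ⟨l, rfl⟩ := hk.two_dvd
    have := X_sq_sub_X_add_one_dvd_X_pow_mul_sub_one l
    rw [show 3 * (2 * l) = 6 * l by ring]
    simpa [sub_eq_add_neg] using this
  · refine ⟨1, Or.inl ⟨rfl, Odd.mul (by decide) hk⟩, ?_⟩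
    simpa using X_sq_sub_X_add_one_dvd_X_pow_mul_add_one hk

theorem eq_two_of_X_sq_sub_X_add_one_eq {k m : ℕ} (hk : 0 < k) (hm : m % 6 = 2) (hmk : m < 6 * k)
    {a b : ℤ[X]} (hab : a * (X ^ m - X + 1) + b * (X ^ (6 * k) - 1) = X ^ 2 - X + 1) :
    m = 2 := by
  obtain ⟨ε, hε, q, hq⟩ := exists_sign_dvd_X_pow_add k
  obtain ⟨g, hg⟩ := X_sq_sub_X_add_one_dvd_trinomial hm
  have hεε : ε * ε = 1 := by rcases hε with ⟨rfl, -⟩ | ⟨rfl, -⟩ <;> rfl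
  have hCε : (Polynomial.C ε * Polynomial.C ε : ℤ[X]) = 1 := by
    rw [← Polynomial.C_mul, hεε, Polynomial.C_1]
  have hag : a * g + (X ^ (3 * k) - Polynomial.C ε) * (b * q) = 1 := by
    refine mul_left_cancel₀ X_sq_sub_X_add_one_ne_zero ?_
    rw [mul_one]
    conv_rhs => rw [← hab]
    rw [hg, show 6 * k = 3 * k + 3 * k by ring, pow_add]
    linear_combination -b * (X ^ (3 * k) - Polynomial.C ε) * hq - b * hCε
  have hN : 0 < 3 * k := by omega
  set A : ℤ[T;T⁻¹] := toLaurent a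
  set G : ℤ[T;T⁻¹] := toLaurent g
  set B : ℤ[T;T⁻¹] := toLaurent (b * q)
  set w : ℤ[T;T⁻¹] := T (3 * k : ℕ) - LaurentPolynomial.C ε
  have hAG : A * G + w * B = 1 := by
    have := congrArg toLaurent hag
    rw [map_add, map_mul, map_mul, map_sub, toLaurent_X_pow, toLaurent_C, map_one] at this
    exact this
  have hF : T m - T 1 + 1 = (T 2 - T 1 + 1) * G := by
    have := congrArg toLaurent hg
    simp only [map_add, map_sub, map_mul, toLaurent_X_pow, toLaurent_X, map_one] at this
    exact_mod_cast this
  have hF' := congrArg invert hF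
  have hAG' := congrArg invert hAG
  -- The ideal (w) is stable under inversion, so congruences modulo w can be conjugated.
  have hw : invert w = w * (-LaurentPolynomial.C ε * T (-(3 * k : ℕ))) := by
    have h1 : (T (3 * k : ℕ) * T (-(3 * k : ℕ)) : ℤ[T;T⁻¹]) = 1 := by
      rw [← T_add, add_neg_cancel, T_zero]
    have h2 : (LaurentPolynomial.C ε * LaurentPolynomial.C ε : ℤ[T;T⁻¹]) = 1 := by
      rw [← map_mul, hεε, map_one]
    rw [map_sub, invert_T, invert_C]
    linear_combination (LaurentPolynomial.C ε) * h1 - T (-(3 * k : ℕ)) * h2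
  simp only [map_add, map_sub, map_mul, map_one, invert_T, hw] at hF' hAG'
  have t1 : (T (-2) * T 2 : ℤ[T;T⁻¹]) = 1 := by rw [← T_add]; exact T_zero
  have t2 : (T (-2) * T 1 : ℤ[T;T⁻¹]) = T (-1) := by rw [← T_add]; rfl
  -- A inverts G modulo w, so this is the unit x⁻²Ḡ/G.
  have hv : T (-2) * invert G * A * invert (T (-2) * invert G * A) =
      1 + w * (-B + (-LaurentPolynomial.C ε * T (-(3 * k : ℕ))) * (-invert B * (A * G))) := by
    simp only [map_mul, invert_T, LaurentPolynomial.involutive_invert G, neg_neg]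
    linear_combination (invert G * A * G * invert A) * t1 + hAG + A * G * hAG'
  have hvf : T (-2) * invert G * A * (T m - T 1 + 1) =
      (T (-(m : ℤ)) - T (-1) + 1) + w * (-B * (T (-(m : ℤ)) - T (-1) + 1)) := by
    rw [hF, hF']
    linear_combination (invert G * A * G) * (t1 - t2) +
      (T (-2) - T (-1) + 1) * invert G * hAG
  obtain ⟨σ, i, hσ, h⟩ := exists_shift_of_mul_invert_eq_one hN hεε hv hvf
  refine eq_two_of_signedIndicator_shift (N := 3 * k) (ε := ε) (σ := σ) (i := i)
    (by push_cast; exact dvd_mul_right _ _) hε hm (by omega) hσ fun j => ?_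
  have hj := h j
  simp only [add_mul, sub_mul, one_mul, ← T_add, map_add, map_sub, twistedTrace_T] at hj
  rw [show j - m = -m + j by ring, show j - 1 = -1 + j by ring,
    show i + j + m = m + (i + j) by ring, show i + j + 1 = 1 + (i + j) by ring]
  linear_combination hj

end Polynomial

end LaurentPolynomial

/-! ### Common roots and ideal membership up to an integer factor -/

section CommonRoots

open Polynomial

theorem exists_C_mul_map_eq (u : ℚ[X]) :
    ∃ (c : ℤ) (v : ℤ[X]), c ≠ 0 ∧ v.map (Int.castRingHom ℚ) = C (c : ℚ) * u := by
  obtain ⟨c, hc, h⟩ := IsLocalization.integerNormalization_spec (nonZeroDivisors ℤ) u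
  refine ⟨c, IsLocalization.integerNormalization (nonZeroDivisors ℤ) u,
    nonZeroDivisors.ne_zero hc, ?_⟩
  rw [← smul_eq_C_mul, ← Int.cast_smul_eq_zsmul ℚ c u] at *
  exact h

/-- If `q` has no repeated roots and every common complex root of `q` and `r` is a root of `p`,
then a nonzero integer multiple of `p` lies in the ideal of `ℤ[X]` generated by `q` and `r`. -/
theorem exists_C_mul_eq_of_common_roots {p q r : ℤ[X]}
    (hq : (q.map (Int.castRingHom ℚ)).Separable)
    (h : ∀ z : ℂ, aeval z q = 0 → aeval z r = 0 → aeval z p = 0) :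
    ∃ (c : ℤ) (a b : ℤ[X]), c ≠ 0 ∧ C c * p = a * q + b * r := by
  set φ := Int.castRingHom ℚ with hφ
  have hev : ∀ (z : ℂ) (s : ℤ[X]), aeval z (s.map φ) = aeval z s := fun z s =>
    aeval_map_algebraMap ℚ z s
  set d := EuclideanDomain.gcd (q.map φ) (r.map φ) with hd
  have hdq : d ∣ q.map φ := EuclideanDomain.gcd_dvd_left _ _
  have hdr : d ∣ r.map φ := EuclideanDomain.gcd_dvd_right _ _
  have hdp : d ∣ p.map φ := by
    rcases eq_or_ne p 0 with rfl | hp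
    · simp
    -- The gcd d inherits simple roots from q, so d ∣ p can be tested on roots.
    have hds : d.Separable := hq.of_dvd hdq
    rw [← map_dvd_map' (algebraMap ℚ ℂ)]
    refine (IsAlgClosed.splits _).dvd_of_roots_le_roots
      (Polynomial.map_ne_zero hds.ne_zero) ?_
    rw [Multiset.le_iff_subset (nodup_roots hds.map)]
    intro z hz
    have hz' : aeval z d = 0 := by
      rw [← eval_map_algebraMap]
      exact isRoot_of_mem_roots hz
    have hpz : aeval z p = 0 := h z
      (by rw [← hev]; exact aeval_eq_zero_of_dvd_aeval_eq_zero hdq hz')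
      (by rw [← hev]; exact aeval_eq_zero_of_dvd_aeval_eq_zero hdr hz')
    rw [mem_roots]
    · rw [IsRoot.def, eval_map_algebraMap, hev, hpz]
    · exact Polynomial.map_ne_zero ((Polynomial.map_ne_zero_iff φ.injective_int).2 hp)
  obtain ⟨e, he⟩ := hdp
  have hbez := EuclideanDomain.gcd_eq_gcd_ab (q.map φ) (r.map φ)
  rw [← hd] at hbez
  obtain ⟨c₁, a, hc₁, ha⟩ := exists_C_mul_map_eq (EuclideanDomain.gcdA (q.map φ) (r.map φ) * e)
  obtain ⟨c₂, b, hc₂, hb⟩ := exists_C_mul_map_eq (EuclideanDomain.gcdB (q.map φ) (r.map φ) * e)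
  refine ⟨c₁ * c₂, C c₂ * a, C c₁ * b, mul_ne_zero hc₁ hc₂, map_injective φ φ.injective_int ?_⟩
  rw [Polynomial.map_mul, Polynomial.map_add, Polynomial.map_mul, Polynomial.map_mul,
    Polynomial.map_mul, Polynomial.map_mul, ha, hb, he, map_C, map_C, map_C, map_mul, C_mul]
  simp only [hφ, eq_intCast] at hbez ⊢
  linear_combination (C (c₁ : ℚ) * C (c₂ : ℚ) * e) * hbez

theorem sq_sub_add_one_eq_zero_of_norm_eq_one {z : ℂ} (h : ‖z‖ = 1) (h' : ‖z - 1‖ = 1) :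
    z ^ 2 - z + 1 = 0 := by
  have e1 : z * (starRingEnd ℂ) z = 1 := by rw [Complex.mul_conj', h]; norm_num
  have e2 : (z - 1) * (starRingEnd ℂ) (z - 1) = 1 := by rw [Complex.mul_conj', h']; norm_num
  rw [map_sub, map_one] at e2
  linear_combination (-z) * e2 + (z - 1) * e1

theorem isPrimitiveRoot_six_of_sq_sub_add_one {z : ℂ} (h : z ^ 2 - z + 1 = 0) :
    IsPrimitiveRoot z 6 := by
  rw [← Polynomial.isRoot_cyclotomic_iff, cyclotomic_six]
  simpa using h

theorem modEq_two_of_common_root {n m : ℕ} (hn : 1 ≤ n) {z : ℂ} (h : z ^ n = 1)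
    (h' : z ^ m - z + 1 = 0) : z ^ 2 - z + 1 = 0 ∧ 6 ∣ n ∧ m % 6 = 2 := by
  have hz : ‖z‖ = 1 := Complex.norm_eq_one_of_pow_eq_one h (by omega)
  have hz1 : ‖z - 1‖ = 1 := by
    rw [show z - 1 = z ^ m by linear_combination -h', norm_pow, hz, one_pow]
  have hΦ := sq_sub_add_one_eq_zero_of_norm_eq_one hz hz1
  have hprim := isPrimitiveRoot_six_of_sq_sub_add_one hΦ
  refine ⟨hΦ, hprim.dvd_of_pow_eq_one n h, ?_⟩
  have h2 : z ^ m = z ^ 2 := by linear_combination h' - hΦ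
  rw [pow_eq_pow_mod m hprim.pow_eq_one] at h2
  exact hprim.pow_inj (Nat.mod_lt _ (by norm_num)) (by norm_num) h2

end CommonRoots

/-! ### The abelianization as a quotient of ℤ[X] -/

section Abelianization

variable {n m : ℕ}

/-- The image of the generator `x_i` in the abelianization. -/
def abGen (n m : ℕ) (i : ZMod n) : Additive (Abelianization (GilbertHowieGroup n m)) :=
  Additive.ofMul (Abelianization.of (PresentedGroup.of i))

theorem abGen_add_abGen (i : ZMod n) :
    abGen n m i + abGen n m (i + m) = abGen n m (i + 1) := by
  have h : (PresentedGroup.of i * PresentedGroup.of (i + m) *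
      (PresentedGroup.of (i + (1 : ℕ)))⁻¹ : GilbertHowieGroup n m) = 1 :=
    PresentedGroup.one_of_mem (rels := fibonacciTypeRelators n m 1) ⟨i, rfl⟩
  rw [mul_inv_eq_one, Nat.cast_one] at h
  rw [abGen, abGen, abGen, ← ofMul_mul, ← map_mul, h]

/-- The homomorphism out of the abelianization determined by a solution of the defining
relations in an additive commutative group. -/
def abLift {B : Type*} [AddCommGroup B] (c : ZMod n → B)
    (hc : ∀ i, c i + c (i + m) = c (i + 1)) :
    Additive (Abelianization (GilbertHowieGroup n m)) →+ B :=
  MonoidHom.toAdditiveLeft <| Abelianization.lift <|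
    PresentedGroup.toGroup (f := fun i => Multiplicative.ofAdd (c i)) <| by
      rintro _ ⟨i, rfl⟩
      simp only [map_mul, map_inv, FreeGroup.lift_apply_of, Nat.cast_one, ← ofAdd_add, hc]
      exact mul_inv_cancel _

theorem abLift_abGen {B : Type*} [AddCommGroup B] (c : ZMod n → B)
    (hc : ∀ i, c i + c (i + m) = c (i + 1)) (i : ZMod n) : abLift c hc (abGen n m i) = c i := by
  simp [abLift, abGen]

theorem abHom_ext {B : Type*} [AddCommGroup B]
    {f g : Additive (Abelianization (GilbertHowieGroup n m)) →+ B}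
    (h : ∀ i, f (abGen n m i) = g (abGen n m i)) : f = g := by
  apply MonoidHom.toAdditiveLeft.symm.injective
  apply Abelianization.hom_ext
  apply PresentedGroup.ext
  intro i
  exact congrArg Multiplicative.ofAdd (h i)

section Polynomial

open Polynomial

/-- The ideal of `ℤ[X]` whose quotient is the abelianization of `H(n,m)`. -/
noncomputable def relationIdeal (n m : ℕ) : Ideal ℤ[X] := Ideal.span {X ^ n - 1, X ^ m - X + 1}

/-- The map `ℤ[X] → H(n,m)^ab` sending `X ^ j` to the class of `x_j`. -/
noncomputable def polyToAb (n m : ℕ) :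
    ℤ[X] →ₗ[ℤ] Additive (Abelianization (GilbertHowieGroup n m)) :=
  lsum fun j => LinearMap.toSpanSingleton ℤ _ (abGen n m j)

theorem polyToAb_monomial (j : ℕ) (a : ℤ) :
    polyToAb n m (monomial j a) = a • abGen n m j := by
  simp [polyToAb, sum_monomial_index]

theorem polyToAb_mul_X_pow_sub_one (p : ℤ[X]) : polyToAb n m (p * (X ^ n - 1)) = 0 := by
  induction p using Polynomial.induction_on' with
  | add p q hp hq => rw [add_mul, map_add, hp, hq, add_zero]
  | monomial j a =>
    rw [mul_sub, mul_one, monomial_mul_X_pow, map_sub, polyToAb_monomial, polyToAb_monomial]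
    simp

theorem polyToAb_mul_trinomial (p : ℤ[X]) : polyToAb n m (p * (X ^ m - X + 1)) = 0 := by
  induction p using Polynomial.induction_on' with
  | add p q hp hq => rw [add_mul, map_add, hp, hq, add_zero]
  | monomial j a =>
    rw [mul_add, mul_sub, mul_one, monomial_mul_X_pow, monomial_mul_X, map_add, map_sub,
      polyToAb_monomial, polyToAb_monomial, polyToAb_monomial, Nat.cast_add, Nat.cast_add,
      Nat.cast_one, ← abGen_add_abGen, smul_add]
    abel

theorem polyToAb_eq_zero_of_mem {p : ℤ[X]} (hp : p ∈ relationIdeal n m) :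
    polyToAb n m p = 0 := by
  obtain ⟨a, b, rfl⟩ := Ideal.mem_span_pair.1 hp
  rw [map_add, polyToAb_mul_X_pow_sub_one, polyToAb_mul_trinomial, add_zero]

theorem mem_of_polyToAb_eq_zero [NeZero n] {p : ℤ[X]} (hp : polyToAb n m p = 0) :
    p ∈ relationIdeal n m := by
  set π := Ideal.Quotient.mk (relationIdeal n m) with hπ
  have hX : π X ^ n = 1 := by
    rw [← map_pow, ← sub_eq_zero, ← map_one π, ← map_sub, hπ, Ideal.Quotient.eq_zero_iff_mem]
    exact Ideal.subset_span (by simp)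
  have hf : π X ^ m - π X + 1 = 0 := by
    rw [← map_pow, ← map_one π, ← map_sub, ← map_add, hπ, Ideal.Quotient.eq_zero_iff_mem]
    exact Ideal.subset_span (by simp)
  have hc : ∀ j : ℕ, π X ^ (j : ZMod n).val = π X ^ j := fun j => by
    rw [ZMod.val_natCast, ← pow_eq_pow_mod j hX]
  let ψ := abLift (n := n) (m := m) (fun i => π X ^ i.val) (fun i => by
    obtain ⟨j, rfl⟩ := ZMod.natCast_zmod_surjective i
    rw [← Nat.cast_add, ← Nat.cast_succ, hc, hc, hc, pow_add, pow_succ]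
    linear_combination π X ^ j * hf)
  -- Following `polyToAb` by ψ gives the quotient map, so the kernel is no larger than the ideal.
  have hψ : ∀ q : ℤ[X], ψ (polyToAb n m q) = π q := fun q => by
    induction q using Polynomial.induction_on' with
    | add p q hp hq => rw [map_add, map_add, hp, hq, map_add]
    | monomial j a =>
      rw [polyToAb_monomial, map_zsmul, abLift_abGen, hc, ← map_pow, ← map_zsmul,
        smul_X_eq_monomial]
  rw [← Ideal.Quotient.eq_zero_iff_mem, ← hπ, ← hψ, hp, map_zero]

theorem subsingleton_of_one_mem [NeZero n] (h : 1 ∈ relationIdeal n m) :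
    Subsingleton (Additive (Abelianization (GilbertHowieGroup n m))) := by
  have hgen : ∀ i, abGen n m i = 0 := fun i => by
    obtain ⟨j, rfl⟩ := ZMod.natCast_zmod_surjective i
    have := polyToAb_eq_zero_of_mem (Ideal.mul_mem_left _ (monomial j 1) h)
    rwa [mul_one, polyToAb_monomial, one_smul] at this
  have hid : AddMonoidHom.id (Additive (Abelianization (GilbertHowieGroup n m))) = 0 :=
    abHom_ext fun i => hgen i
  exact subsingleton_of_forall_eq 0 fun x => DFunLike.congr_fun hid x

/-- Vanishing on the common roots gives membership up to a nonzero integer, which torsion-freeness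
cancels. -/
theorem mem_of_common_roots [NeZero n]
    [IsAddTorsionFree (Additive (Abelianization (GilbertHowieGroup n m)))] {p : ℤ[X]}
    (h : ∀ z : ℂ, z ^ n = 1 → z ^ m - z + 1 = 0 → aeval z p = 0) : p ∈ relationIdeal n m := by
  have hsep : ((X ^ n - 1 : ℤ[X]).map (Int.castRingHom ℚ)).Separable := by
    simp only [Polynomial.map_sub, Polynomial.map_pow, map_X, Polynomial.map_one]
    exact X_pow_sub_one_separable_iff.2 (NeZero.ne _)
  obtain ⟨c, a, b, hc, hab⟩ := exists_C_mul_eq_of_common_roots (p := p) (r := X ^ m - X + 1) hsep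
    fun z hz hz' => h z (by simpa [sub_eq_zero] using hz) (by simpa using hz')
  apply mem_of_polyToAb_eq_zero
  have h0 : c • polyToAb n m p = 0 := by
    rw [← map_zsmul, smul_eq_C_mul, hab]
    exact polyToAb_eq_zero_of_mem (Ideal.mem_span_pair.2 ⟨a, b, rfl⟩)
  exact (smul_eq_zero.1 h0).resolve_left hc

/-- If `H(n,m)^ab` is nontrivial and torsion-free, then `6 ∣ n` and `m = 2`. -/
theorem six_dvd_and_eq_two_of_torsionFree (hn : 1 ≤ n) (hm : m < n)
    [IsAddTorsionFree (Additive (Abelianization (GilbertHowieGroup n m)))]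
    [Nontrivial (Additive (Abelianization (GilbertHowieGroup n m)))] : 6 ∣ n ∧ m = 2 := by
  have : NeZero n := ⟨by omega⟩
  have hmod : 6 ∣ n ∧ m % 6 = 2 := by
    by_contra hcon
    -- With no common roots, 1 vanishes on all of them vacuously.
    have := subsingleton_of_one_mem (n := n) (m := m)
      (mem_of_common_roots fun z hz hz' => absurd (modEq_two_of_common_root hn hz hz').2 hcon)
    exact not_subsingleton _ this
  obtain ⟨⟨k, rfl⟩, hm2⟩ := hmod
  refine ⟨dvd_mul_right _ _, ?_⟩
  have hΦ : (X ^ 2 - X + 1 : ℤ[X]) ∈ relationIdeal (6 * k) m :=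
    mem_of_common_roots fun z hz hz' => by
      simpa using (modEq_two_of_common_root hn hz hz').1
  obtain ⟨b, a, hab⟩ := Ideal.mem_span_pair.1 hΦ
  exact eq_two_of_X_sq_sub_X_add_one_eq (by omega) hm2 hm ((add_comm _ _).trans hab)

end Polynomial

/-! ### The converse: m = 2 and 6 ∣ n -/

/-- The six-periodic solution of `c i + c (i + 2) = c (i + 1)` with `c 0 = (1, 0)`,
`c 1 = (0, 1)`. -/
def hexCycle : ZMod 6 → ℤ × ℤ := ![(1, 0), (0, 1), (-1, 1), (-1, 0), (0, -1), (1, -1)]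

theorem hexCycle_add (i : ZMod 6) : hexCycle i + hexCycle (i + 2) = hexCycle (i + 1) := by
  revert i
  decide

/-- For `6 ∣ n`, the abelianization of `H(n,2)` is free abelian on `x_0`, `x_1`. -/
theorem nonempty_addEquiv_of_six_dvd [NeZero n] (h : 6 ∣ n) :
    Nonempty (Additive (Abelianization (GilbertHowieGroup n 2)) ≃+ ℤ × ℤ) := by
  let f : Additive (Abelianization (GilbertHowieGroup n 2)) →+ ℤ × ℤ :=
    abLift (fun i => hexCycle (ZMod.castHom h (ZMod 6) i)) fun i => by
      simpa only [map_add, map_ofNat, map_one, Nat.cast_ofNat] using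
        hexCycle_add (ZMod.castHom h (ZMod 6) i)
  have hf : ∀ i, f (abGen n 2 i) = hexCycle (ZMod.castHom h (ZMod 6) i) := abLift_abGen _ _
  have hf0 : f (abGen n 2 0) = (1, 0) := by rw [hf, map_zero]; rfl
  have hf1 : f (abGen n 2 1) = (0, 1) := by rw [hf, map_one]; rfl
  let g : ℤ × ℤ →+ Additive (Abelianization (GilbertHowieGroup n 2)) :=
    AddMonoidHom.coprod (zmultiplesHom _ (abGen n 2 0)) (zmultiplesHom _ (abGen n 2 1))
  have hg : ∀ x : ℤ × ℤ, g x = x.1 • abGen n 2 0 + x.2 • abGen n 2 1 := fun x => by simp [g]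
  have hgf : g.comp f = AddMonoidHom.id _ := by
    refine abHom_ext fun i => ?_
    obtain ⟨j, rfl⟩ := ZMod.natCast_zmod_surjective i
    -- The recurrence has order two, so the induction carries consecutive pairs.
    have key : ∀ j : ℕ, g (f (abGen n 2 j)) = abGen n 2 j ∧
        g (f (abGen n 2 (j + 1))) = abGen n 2 (j + 1) := fun j => by
      induction j with
      | zero => simp [hf0, hf1, hg]
      | succ j ih =>
        refine ⟨by simpa using ih.2, ?_⟩
        have e : abGen n 2 ((j : ZMod n) + 2) = abGen n 2 (j + 1) - abGen n 2 j := by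
          have := abGen_add_abGen (n := n) (m := 2) j
          rw [Nat.cast_ofNat] at this
          rw [← this, add_sub_cancel_left]
        rw [Nat.cast_succ, add_assoc, one_add_one_eq_two, e, map_sub, map_sub, ih.1, ih.2]
    exact (key j).1
  have hfg : f.comp g = AddMonoidHom.id _ := by
    ext <;> simp [hg, hf0, hf1]
  exact ⟨f.toAddEquiv g hgf hfg⟩

end Abelianization

theorem mainTheorem1 (n m : ℕ) (hn : 1 ≤ n) (hm : m < n) :
    Nonempty (Additive (Abelianization (GilbertHowieGroup n m)) ≃+ ℤ × ℤ) ↔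
      n ≡ 0 [MOD 6] ∧ m ≡ 2 [MOD n] := by
  constructor
  · rintro ⟨e⟩
    have : IsAddTorsionFree (Additive (Abelianization (GilbertHowieGroup n m))) :=
      e.injective.isAddTorsionFree e.toAddMonoidHom
    have : Nontrivial (Additive (Abelianization (GilbertHowieGroup n m))) :=
      e.toEquiv.nontrivial
    obtain ⟨h6, rfl⟩ := six_dvd_and_eq_two_of_torsionFree hn hm
    exact ⟨(Nat.modEq_zero_iff_dvd).2 h6, rfl⟩
  · rintro ⟨h6, h2⟩
    have h6' := Nat.modEq_zero_iff_dvd.1 h6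
    have : NeZero n := ⟨by omega⟩
    have hn6 := Nat.le_of_dvd (by omega) h6'
    obtain rfl : m = 2 := Nat.ModEq.eq_of_lt_of_lt h2 hm (by omega)
    exact nonempty_addEquiv_of_six_dvd h6'
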